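/- Let $f:\mathbb R^n\to\mathbb R^n$ and $B\in\mathbb R^{n\times m}$, and consider the system $\dot x=f(x)+Bu$. Suppose that $f(x)=AZ(x)$ for some matrix $A\in\mathbb R^{n\times s}$, where $s\ge n$, $Z(x)=\begin{bmatrix}x\\ Q(x)\end{bmatrix}$ and $Q:\mathbb R^n\to\mathbb R^{s-n}$ is continuously differentiable. Let samples $x_i\in\mathbb R^n$, $u_i\in\mathbb R^m$, $\dot x_i\in\mathbb R^n$ satisfy $\dot x_i=f(x_i)+Bu_i$ for $i=0,\dots,T-1$, and set $$U_0=[u_0\ \cdots\ u_{T-1}],\qquad X_1=[\dot x_0\ \cdots\ \dot x_{T-1}],\qquad Z_0=[Z(x_0)\ \cdots\ Z(x_{T-1})].$$ Let $\mathcal X\subseteq\mathbb R^n$ and $R_Q\in\mathbb R^{n\times\tau}$ be such that $\frac{\partial Q}{\partial x}(x)^\top\frac{\partial Q}{\partial x}(x)\preceq R_QR_Q^\top$ for all $x\in\mathcal X$. Suppose that a symmetric matrix $P\succ0$ in $\mathbb R^{n\times n}$, matrices $Y_1\in\mathbb R^{T\times n}$, $G_2\in\mathbb R^{T\times(s-n)}$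 and a real number $\alpha>0$ satisfy $$Z_0Y_1=\begin{bmatrix}P\\0\end{bmatrix},\qquad Z_0G_2=\begin{bmatrix}0\\I_{s-n}\end{bmatrix},\qquad \begin{bmatrix}X_1Y_1+(X_1Y_1)^\top+\alpha I_n & X_1G_2 & PR_Q\\ (X_1G_2)^\top & -I_{s-n} & 0\\ R_Q^\top P & 0 & -I_\tau\end{bmatrix}\preceq0,$$ let $K=U_0\begin{bmatrix}Y_1P^{-1} & G_2\end{bmatrix}$, and consider the closed-loop system $$\dot x=(A+BK)Z(x).\tag{$*$}$$ Assume that either (i) $\mathcal X$ is nonempty, convex, closed and forward invariant for $(*)$ (every solution that starts in $\mathcal X$ stays in $\mathcal X$ as long as it exists), and $(*)$ is forward complete on $\mathcal X$ (from every point of $\mathcal X$ a solution exists for all future time), or (ii) $\mathcal X=\mathbb R^n$. Then $(*)$ has a unique equilibrium point $x_*$ in $\mathcal X$. Moreover, $x_*$ is uniformly exponentially stable for $(*)$: there are $\delta,c,\lambda>0$ such that, for every initial time $t_0$, every solution of $(*)$ with $|x(t_0)-x_*|<\delta$ extends to $[t_0,\infty)$ and satisfies $|x(t)-x_*|\le c\,e^{-\lambda(t-t_0)}|x(t_0)-x_*|$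 for all $t\ge t_0$. Finally, every solution of $(*)$ initialized in $\mathcal X$ converges uniformly exponentially to $x_*$: there are $c',\lambda'>0$ such that, for every $t_0$, every solution with $x(t_0)\in\mathcal X$ extends to $[t_0,\infty)$ and satisfies $|x(t)-x_*|\le c'e^{-\lambda'(t-t_0)}|x(t_0)-x_*|$ for all $t\ge t_0$. -/

import Mathlib

open Matrix

/-- The Euclidean space `ℝᵏ`, with the 2-norm. -/
abbrev Vec (k : ℕ) : Type := EuclideanSpace ℝ (Fin k)

section Dictionary

variable {n m q τ T : ℕ}

/-- The dictionary `Z(x) = [x ; Q(x)]`, a vector with `s = n + q` entries. -/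
def dictionary (Q : Vec n → Vec q) (x : Vec n) : Fin n ⊕ Fin q → ℝ :=
  Sum.elim (fun i => x i) (fun j => Q x j)

/-- The Jacobian matrix `∂Q/∂x (x)`. -/
noncomputable def jacobian (Q : Vec n → Vec q) (x : Vec n) : Matrix (Fin q) (Fin n) ℝ :=
  Matrix.of fun i j => fderiv ℝ Q x (EuclideanSpace.single j 1) i

/-- The bound `(∂Q/∂x)ᵀ (∂Q/∂x) ⪯ R_Q R_Qᵀ` at every point of `X`. -/
def JacobianBound (Q : Vec n → Vec q) (RQ : Matrix (Fin n) (Fin τ) ℝ) (X : Set (Vec n)) : Prop :=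
  ∀ x ∈ X, (RQ * RQᵀ - (jacobian Q x)ᵀ * jacobian Q x).PosSemidef

/-- The matrix whose columns are the given samples. -/
def sampleMatrix {k : ℕ} (v : Fin T → Vec k) : Matrix (Fin k) (Fin T) ℝ :=
  Matrix.of fun i t => v t i

/-- The matrix whose columns are the dictionary evaluated at the state samples. -/
def dictionaryMatrix (Q : Vec n → Vec q) (x : Fin T → Vec n) :
    Matrix (Fin n ⊕ Fin q) (Fin T) ℝ :=
  Matrix.of fun i t => dictionary Q (x t) i

/-- The symmetric block matrix of the linear matrix inequality. -/
def lmiMatrix (X₁ : Matrix (Fin n) (Fin T) ℝ) (RQ : Matrix (Fin n) (Fin τ) ℝ)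
    (P : Matrix (Fin n) (Fin n) ℝ) (Y₁ : Matrix (Fin T) (Fin n) ℝ)
    (G₂ : Matrix (Fin T) (Fin q) ℝ) (α : ℝ) :
    Matrix ((Fin n ⊕ Fin q) ⊕ Fin τ) ((Fin n ⊕ Fin q) ⊕ Fin τ) ℝ :=
  fromBlocks
    (fromBlocks
      (X₁ * Y₁ + (X₁ * Y₁)ᵀ + α • (1 : Matrix (Fin n) (Fin n) ℝ)) (G₂ᵀ * X₁ᵀ)ᵀ
      (G₂ᵀ * X₁ᵀ) (-1))
    (fromRows (RQᵀ * P)ᵀ 0)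
    (fromCols (RQᵀ * P) 0)
    (-1)

/-- `(P, Y₁, G₂, α)` is a feasible point of the semidefinite program given by the data matrices
`X₁`, `Z₀` and the bound `R_Q`. -/
structure SDPFeasible (X₁ : Matrix (Fin n) (Fin T) ℝ) (Z₀ : Matrix (Fin n ⊕ Fin q) (Fin T) ℝ)
    (RQ : Matrix (Fin n) (Fin τ) ℝ) (P : Matrix (Fin n) (Fin n) ℝ)
    (Y₁ : Matrix (Fin T) (Fin n) ℝ) (G₂ : Matrix (Fin T) (Fin q) ℝ) (α : ℝ) : Prop where
  alpha_pos : 0 < α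
  posDef : P.PosDef
  consistency_left : Z₀ * Y₁ = fromRows P 0
  lmi : (-(lmiMatrix X₁ RQ P Y₁ G₂ α)).PosSemidef
  consistency_right : Z₀ * G₂ = fromRows 0 1

/-- The controller gain `K = U₀ [Y₁ P⁻¹  G₂]`. -/
noncomputable def gain (U₀ : Matrix (Fin m) (Fin T) ℝ) (P : Matrix (Fin n) (Fin n) ℝ)
    (Y₁ : Matrix (Fin T) (Fin n) ℝ) (G₂ : Matrix (Fin T) (Fin q) ℝ) :
    Matrix (Fin m) (Fin n ⊕ Fin q) ℝ :=
  U₀ * fromCols (Y₁ * P⁻¹) G₂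

/-- The closed-loop vector field `x ↦ (A + B K) Z(x)`. -/
def closedLoop (A : Matrix (Fin n) (Fin n ⊕ Fin q) ℝ) (B : Matrix (Fin n) (Fin m) ℝ)
    (K : Matrix (Fin m) (Fin n ⊕ Fin q) ℝ) (Q : Vec n → Vec q) (x : Vec n) : Vec n :=
  WithLp.toLp 2 ((A + B * K) *ᵥ dictionary Q x)

end Dictionary

section Dynamics

variable {n : ℕ}

/-- `x` is a solution of `ẋ = F(x)`, `x(t₀) = ξ`, on the interval `J`, whose left endpoint `t₀`
belongs to `J`. The interval may be bounded or unbounded, open or closed on the right. -/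
structure IsForwardSolution (F : Vec n → Vec n) (t₀ : ℝ) (ξ : Vec n) (J : Set ℝ)
    (x : ℝ → Vec n) : Prop where
  ordConnected : J.OrdConnected
  isLeast : IsLeast J t₀
  initial : x t₀ = ξ
  solves : IsIntegralCurveOn x (fun _ => F) J

/-- Solutions that start in `X` stay in `X` as long as they exist. -/
def ForwardInvariant (F : Vec n → Vec n) (X : Set (Vec n)) : Prop :=
  ∀ (t₀ : ℝ), ∀ ξ ∈ X, ∀ (J : Set ℝ) (x : ℝ → Vec n),
    IsForwardSolution F t₀ ξ J x → ∀ t ∈ J, x t ∈ X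

/-- From every initial condition in `X` there is a solution on `[t₀, ∞)`. -/
def ForwardComplete (F : Vec n → Vec n) (X : Set (Vec n)) : Prop :=
  ∀ (t₀ : ℝ), ∀ ξ ∈ X, ∃ x : ℝ → Vec n, IsForwardSolution F t₀ ξ (Set.Ici t₀) x

/-- All solutions that start in `S` exist for all future time and converge to `p` exponentially,
with constants that depend neither on the initial time nor on the initial state. -/
def UniformExpConverges (F : Vec n → Vec n) (S : Set (Vec n)) (p : Vec n) : Prop :=
  ForwardComplete F S ∧
    ∃ c > 0, ∃ r > 0, ∀ (t₀ : ℝ), ∀ ξ ∈ S, ∀ (J : Set ℝ) (x : ℝ → Vec n),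
      IsForwardSolution F t₀ ξ J x →
        ∀ t ∈ J, ‖x t - p‖ ≤ c * Real.exp (-r * (t - t₀)) * ‖ξ - p‖

/-- `p` is uniformly exponentially stable: the estimate holds for all solutions that start in some
ball of `ℝⁿ` centred at `p`. -/
def UniformExpStable (F : Vec n → Vec n) (p : Vec n) : Prop :=
  ∃ δ > 0, UniformExpConverges F (Metric.ball p δ) p

end Dynamics

/-
Tested on `(P⁻¹ v, D v, R_Qᵀ v)` with `D = ∂Q/∂x (x)`, the linear matrix inequality and the Jacobian
bound say that the variational equation of the closed loop contracts the norm `√(vᵀ P⁻¹ v)` on `X`.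
Along a solution `x`, the velocity `F (x t)` solves that equation, so the speed decays
exponentially. Hence solutions in `X` are bounded, so global, and Cauchy at infinity: their limit is
an equilibrium `p`. On a convex set, integrating the contraction along segments makes
`(x - p)ᵀ P⁻¹ (x - p)` an exponential Lyapunov function. As `p` may lie on the boundary of `X`,
stability in a full neighbourhood comes from the linearisation at `p`.
-/

open Set Metric Filter Topology

section LyapunovForm

variable {E : Type*} [NormedAddCommGroup E] [NormedSpace ℝ E]

/-- The bilinear form `b` is symmetric and `v ↦ √(b v v)` is a norm equivalent to that of `E`, with
constants `√m` and `√M`: then `v ↦ b v v` can serve as a quadratic Lyapunov function. -/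
structure IsLyapunovForm (b : E →L[ℝ] E →L[ℝ] ℝ) (m M : ℝ) : Prop where
  symm : ∀ v w, b v w = b w v
  lower_pos : 0 < m
  upper_pos : 0 < M
  lower_le : ∀ v, m * ‖v‖ ^ 2 ≤ b v v
  le_upper : ∀ v, b v v ≤ M * ‖v‖ ^ 2

theorem exists_lower_bound_of_forall_pos [FiniteDimensional ℝ E] {b : E →L[ℝ] E →L[ℝ] ℝ}
    (hpos : ∀ v ≠ 0, 0 < b v v) : ∃ m > 0, ∀ v, m * ‖v‖ ^ 2 ≤ b v v := by
  obtain ⟨m, hm, hle⟩ := (isCompact_sphere (0 : E) 1).exists_forall_le' (f := fun v => b v v)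
    (by fun_prop) fun v hv => hpos v (ne_zero_of_mem_unit_sphere ⟨v, hv⟩)
  refine ⟨m, hm, fun v => ?_⟩
  rcases eq_or_ne v 0 with rfl | hv
  · simp
  have hnorm : 0 < ‖v‖ := norm_pos_iff.2 hv
  have hunit := hle (‖v‖⁻¹ • v) (by simp [norm_smul, hnorm.ne'])
  simp only [map_smul, _root_.smul_apply, smul_eq_mul] at hunit
  calc m * ‖v‖ ^ 2 ≤ ‖v‖⁻¹ * (‖v‖⁻¹ * b v v) * ‖v‖ ^ 2 := by gcongr
    _ = b v v := by field_simp

theorem exists_isLyapunovForm [FiniteDimensional ℝ E] {b : E →L[ℝ] E →L[ℝ] ℝ}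
    (hsymm : ∀ v w, b v w = b w v) (hpos : ∀ v ≠ 0, 0 < b v v) : ∃ m M, IsLyapunovForm b m M := by
  obtain ⟨m, hm, hle⟩ := exists_lower_bound_of_forall_pos hpos
  refine ⟨m, ‖b‖ + 1, hsymm, hm, by positivity, hle, fun v => ?_⟩
  calc b v v ≤ ‖b‖ * ‖v‖ * ‖v‖ := (le_abs_self _).trans (b.le_opNorm₂ v v)
    _ ≤ (‖b‖ + 1) * ‖v‖ ^ 2 := by nlinarith [sq_nonneg ‖v‖]

namespace IsLyapunovForm

variable {b : E →L[ℝ] E →L[ℝ] ℝ} {m M : ℝ}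

theorem norm_equivalence_pos (hb : IsLyapunovForm b m M) : 0 < √(M / m) :=
  Real.sqrt_pos.2 (div_pos hb.upper_pos hb.lower_pos)

theorem eq_zero_of_nonpos (hb : IsLyapunovForm b m M) {v : E} (hv : b v v ≤ 0) : v = 0 := by
  have hsq : ‖v‖ ^ 2 ≤ 0 := nonpos_of_mul_nonpos_right ((hb.lower_le v).trans hv) hb.lower_pos
  exact norm_eq_zero.1 (pow_eq_zero_iff two_ne_zero |>.1 (hsq.antisymm (sq_nonneg _)))

theorem norm_le_of_le_sq_mul (hb : IsLyapunovForm b m M) {v w : E} {a : ℝ} (ha : 0 ≤ a)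
    (h : b v v ≤ a ^ 2 * b w w) : ‖v‖ ≤ √(M / m) * a * ‖w‖ := by
  have hm := hb.lower_pos
  refine (pow_le_pow_iff_left₀ (norm_nonneg _) (by positivity) two_ne_zero).1 ?_
  calc ‖v‖ ^ 2 ≤ b v v / m := by rw [le_div_iff₀' hm]; exact hb.lower_le v
    _ ≤ a ^ 2 * (M * ‖w‖ ^ 2) / m := by
      gcongr
      exact h.trans (by gcongr; exact hb.le_upper w)
    _ = (√(M / m) * a * ‖w‖) ^ 2 := by
      rw [mul_pow, mul_pow, Real.sq_sqrt (div_pos hb.upper_pos hm).le]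
      ring

theorem hasDerivWithinAt (hb : IsLyapunovForm b m M) {w : ℝ → E} {w' : E} {s : Set ℝ} {t : ℝ}
    (hw : HasDerivWithinAt w w' s t) :
    HasDerivWithinAt (fun t => b (w t) (w t)) (2 * b (w t) w') s t := by
  refine (b.hasDerivWithinAt_of_bilinear hw hw).congr_deriv ?_
  rw [hb.symm w' (w t), two_mul]

theorem norm_le_exp_mul_of_hasDerivWithinAt (hb : IsLyapunovForm b m M) {w w' : ℝ → E}
    {t₀ T κ : ℝ} (hw : ∀ t ∈ Icc t₀ T, HasDerivWithinAt w (w' t) (Icc t₀ T) t)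
    (hdecay : ∀ t ∈ Icc t₀ T, b (w t) (w' t) ≤ -κ * b (w t) (w t)) {t : ℝ} (ht : t ∈ Icc t₀ T) :
    ‖w t‖ ≤ √(M / m) * Real.exp (-κ * (t - t₀)) * ‖w t₀‖ := by
  refine hb.norm_le_of_le_sq_mul (Real.exp_pos _).le ?_
  have hderiv : ∀ s ∈ Icc t₀ T, HasDerivWithinAt (fun t => b (w t) (w t))
      (2 * b (w s) (w' s)) (Icc t₀ T) s := fun s hs => hb.hasDerivWithinAt (hw s hs)
  have hgronwall := le_gronwallBound_of_liminf_deriv_right_le (K := -κ * 2) (ε := 0)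
    (fun s hs => (hderiv s hs).continuousWithinAt)
    (fun s hs r hr => ((hderiv s ⟨hs.1, hs.2.le⟩).mono_of_mem_nhdsWithin
      (Icc_mem_nhdsGE_of_mem hs)).liminf_right_slope_le hr)
    le_rfl (fun s hs => by linarith [hdecay s ⟨hs.1, hs.2.le⟩]) t ht
  rw [gronwallBound_ε0, mul_comm] at hgronwall
  refine hgronwall.trans_eq ?_
  rw [← Real.exp_nat_mul]
  ring_nf

theorem eventually_apply_le_of_hasFDerivAt (hb : IsLyapunovForm b m M) {F : E → E} {F' : E →L[ℝ] E}
    {p : E} {κ κ' : ℝ} (hF : HasFDerivAt F F' p) (hp : F p = 0)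
    (hdecay : ∀ v, b v (F' v) ≤ -κ * b v v) (hκ : κ' < κ) :
    ∀ᶠ x in 𝓝 p, b (x - p) (F x) ≤ -κ' * b (x - p) (x - p) := by
  have hm := hb.lower_pos
  have hgap : 0 < κ - κ' := sub_pos.2 hκ
  have hsmall := hF.isLittleO.def (c := (κ - κ') * m / (‖b‖ + 1)) (by positivity)
  filter_upwards [hsmall] with x hx
  rw [hp, sub_zero] at hx
  have hremainder : b (x - p) (F x - F' (x - p)) ≤ (κ - κ') * b (x - p) (x - p) := by
    calc b (x - p) (F x - F' (x - p))
        ≤ ‖b‖ * ‖x - p‖ * ‖F x - F' (x - p)‖ := (le_abs_self _).trans (b.le_opNorm₂ _ _)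
      _ ≤ (‖b‖ + 1) * ‖x - p‖ * ((κ - κ') * m / (‖b‖ + 1) * ‖x - p‖) := by gcongr; linarith
      _ = (κ - κ') * (m * ‖x - p‖ ^ 2) := by field_simp
      _ ≤ (κ - κ') * b (x - p) (x - p) := by
        gcongr
        exact hb.lower_le _
  rw [map_sub] at hremainder
  linarith [hdecay (x - p)]

end IsLyapunovForm

end LyapunovForm

section Contraction

variable {E : Type*} [NormedAddCommGroup E] [NormedSpace ℝ E] {b : E →L[ℝ] E →L[ℝ] ℝ}
  {m M κ : ℝ} {F : E → E} {X : Set E}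

/-- Demidovich's condition: along `X`, the variational equation `v̇ = F'(x) v` of `ẋ = F(x)` makes
`√(b v v)` decay at least at the rate `κ`. -/
def IsInfinitesimallyContractingOn (b : E →L[ℝ] E →L[ℝ] ℝ) (κ : ℝ) (F : E → E) (X : Set E) :
    Prop :=
  ∀ x ∈ X, ∀ v, b v (fderiv ℝ F x v) ≤ -κ * b v v

namespace IsInfinitesimallyContractingOn

theorem apply_sub_le (h : IsInfinitesimallyContractingOn b κ F X) (hF : Differentiable ℝ F)
    (hX : Convex ℝ X) {x y : E} (hx : x ∈ X) (hy : y ∈ X) :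
    b (x - y) (F x - F y) ≤ -κ * b (x - y) (x - y) := by
  have hline : ∀ s : ℝ, HasDerivAt (fun s : ℝ => b (x - y) (F (y + s • (x - y))))
      (b (x - y) (fderiv ℝ F (y + s • (x - y)) (x - y))) s := fun s => by
    have hsegment : HasDerivAt (fun s : ℝ => y + s • (x - y)) (x - y) s := by
      simpa using ((hasDerivAt_id s).smul_const (x - y)).const_add y
    exact (b (x - y)).hasFDerivAt.comp_hasDerivAt s
      ((hF _).hasFDerivAt.comp_hasDerivAt s hsegment)
  have hmvt := (convex_Icc (0 : ℝ) 1).image_sub_le_mul_sub_of_deriv_le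
    (fun s _ => (hline s).continuousAt.continuousWithinAt)
    (fun s _ => (hline s).differentiableAt.differentiableWithinAt)
    (fun s hs => (hline s).deriv.trans_le
      (h _ (hX.add_smul_sub_mem hy hx (interior_subset hs)) (x - y)))
    0 (by simp) 1 (by simp) zero_le_one
  rw [map_sub]
  simpa only [one_smul, zero_smul, add_zero, add_sub_cancel, sub_zero, mul_one] using hmvt

theorem norm_field_le (h : IsInfinitesimallyContractingOn b κ F X) (hb : IsLyapunovForm b m M)
    (hF : Differentiable ℝ F) {x : ℝ → E} {t₀ T : ℝ}
    (hx : IsIntegralCurveOn x (fun _ => F) (Icc t₀ T)) (hxX : ∀ t ∈ Icc t₀ T, x t ∈ X) {t : ℝ}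
    (ht : t ∈ Icc t₀ T) :
    ‖F (x t)‖ ≤ √(M / m) * Real.exp (-κ * (t - t₀)) * ‖F (x t₀)‖ :=
  hb.norm_le_exp_mul_of_hasDerivWithinAt
    (fun s hs => (hF (x s)).hasFDerivAt.comp_hasDerivWithinAt s (hx s hs))
    (fun s hs => h _ (hxX s hs) _) ht

theorem norm_sub_le (h : IsInfinitesimallyContractingOn b κ F X) (hb : IsLyapunovForm b m M)
    (hκ : 0 < κ) (hF : Differentiable ℝ F) {x : ℝ → E} {t₀ T : ℝ} (hT : t₀ ≤ T)
    (hx : IsIntegralCurveOn x (fun _ => F) (Icc t₀ T)) (hxX : ∀ t ∈ Icc t₀ T, x t ∈ X) :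
    ‖x T - x t₀‖ ≤ √(M / m) / κ * ‖F (x t₀)‖ := by
  have hboundary : ∀ t, HasDerivAt
      (fun t => √(M / m) / κ * ‖F (x t₀)‖ * (1 - Real.exp (-κ * (t - t₀))))
      (√(M / m) * Real.exp (-κ * (t - t₀)) * ‖F (x t₀)‖) t := fun t => by
    have hexp := ((((hasDerivAt_id t).sub_const t₀).const_mul (-κ)).exp).const_sub 1
    refine (hexp.const_mul (√(M / m) / κ * ‖F (x t₀)‖)).congr_deriv ?_
    simp only [id_eq]
    field_simp
  have hle := image_norm_le_of_norm_deriv_right_le_deriv_boundary (f := fun t => x t - x t₀)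
    (fun t ht => (hx t ht).continuousWithinAt.sub continuousWithinAt_const)
    (fun t ht => ((hx t ⟨ht.1, ht.2.le⟩).sub_const (x t₀)).mono_of_mem_nhdsWithin
      (Icc_mem_nhdsGE_of_mem ht))
    (by simp) hboundary (fun t ht => h.norm_field_le hb hF hx hxX ⟨ht.1, ht.2.le⟩)
    (right_mem_Icc.2 hT)
  refine hle.trans (mul_le_of_le_one_right (by positivity) ?_)
  linarith [Real.exp_pos (-κ * (T - t₀))]

end IsInfinitesimallyContractingOn

end Contraction

section GlobalExistence

variable {E : Type*} [NormedAddCommGroup E] [NormedSpace ℝ E]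

open scoped Manifold

theorem isMIntegralCurveOn_vectorSpace_iff {G : E → E} {x : ℝ → E} {s : Set ℝ} :
    IsMIntegralCurveOn (I := 𝓘(ℝ, E)) x G s ↔ IsIntegralCurveOn x (fun _ => G) s := by
  refine forall₂_congr fun t _ => hasMFDerivWithinAt_iff_hasFDerivWithinAt.trans ?_
  rw [hasDerivWithinAt_iff_hasFDerivWithinAt,
    ← ContinuousLinearMap.smulRight_one_eq_toSpanSingleton]
  rfl

theorem exists_isIntegralCurve_of_hasCompactSupport [CompleteSpace E] {G : E → E}
    (hG : ContDiff ℝ 1 G) (hsupp : HasCompactSupport G) (t₀ : ℝ) (ξ : E) :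
    ∃ x : ℝ → E, x t₀ = ξ ∧ IsIntegralCurve x (fun _ => G) := by
  obtain ⟨K, hK⟩ := hG.lipschitzWith_of_hasCompactSupport hsupp one_ne_zero
  obtain ⟨L, hL⟩ := hG.continuous.bounded_above_of_compact_support hsupp
  have hlocal : ∀ η, ∃ x : ℝ → E, x 0 = η ∧ IsMIntegralCurveOn (I := 𝓘(ℝ, E)) x G (Ioo (-1) 1) := by
    intro η
    have hPL : IsPicardLindelof (fun _ => G) (tmin := -1) (tmax := 1) ⟨0, by simp⟩ η
        L.toNNReal 0 L.toNNReal K :=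
      .of_time_independent (fun y _ => (hL y).trans (Real.le_coe_toNNReal L))
        hK.lipschitzOnWith (by simp)
    obtain ⟨x, hx₀, hx⟩ := hPL.exists_eq_forall_mem_Icc_hasDerivWithinAt₀
    exact ⟨x, hx₀, isMIntegralCurveOn_vectorSpace_iff.2
      (IsIntegralCurveOn.mono hx Ioo_subset_Icc_self)⟩
  obtain ⟨x, hx₀, hx⟩ := exists_isMIntegralCurve_of_isMIntegralCurveOn
    (contMDiff_vectorSpace_iff_contDiff.2 hG) one_pos hlocal ξ
  have hx' : IsIntegralCurve x fun _ => G := isIntegralCurveOn_univ.1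
    (isMIntegralCurveOn_vectorSpace_iff.1 (isMIntegralCurve_iff_isMIntegralCurveOn.1 hx))
  exact ⟨fun t => x (t - t₀), by simpa using hx₀, hx'.comp_sub t₀⟩

theorem exists_first_time_ge {g : ℝ → ℝ} (hg : Continuous g) {a b r : ℝ} (hab : a ≤ b)
    (ha : g a < r) (hb : r ≤ g b) : ∃ τ ∈ Icc a b, r ≤ g τ ∧ ∀ t ∈ Icc a τ, g t ≤ r := by
  obtain ⟨τ, ⟨hτ, hτr⟩, hmin⟩ := (isCompact_Icc.inter_right
    (isClosed_le continuous_const hg)).exists_isLeast ⟨b, right_mem_Icc.2 hab, hb⟩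
  have hbefore : ∀ t ∈ Ico a τ, g t ≤ r := fun t ht =>
    le_of_not_ge fun hrt => ht.2.not_ge (hmin ⟨⟨ht.1, ht.2.le.trans hτ.2⟩, hrt⟩)
  have haτ : a ≠ τ := fun h => (h ▸ hτr).not_gt ha
  refine ⟨τ, hτ, hτr, fun t ht => ?_⟩
  exact ContinuousWithinAt.closure_le (by rwa [closure_Ico haτ]) hg.continuousWithinAt
    continuousWithinAt_const hbefore

theorem exists_isIntegralCurveOn_Ici_of_bounded [FiniteDimensional ℝ E] {F : E → E}
    (hF : ContDiff ℝ 1 F) {t₀ R : ℝ} {ξ : E}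
    (hbound : ∀ (T : ℝ) (x : ℝ → E), t₀ ≤ T → x t₀ = ξ →
      IsIntegralCurveOn x (fun _ => F) (Icc t₀ T) → ‖x T - ξ‖ ≤ R) :
    ∃ x : ℝ → E, x t₀ = ξ ∧ IsIntegralCurveOn x (fun _ => F) (Ici t₀) := by
  -- Cut `F` off outside a ball around `ξ`: by the a priori bound, the solution of the truncated
  -- equation cannot reach the region where the two fields differ.
  let χ : ContDiffBump ξ := ⟨|R| + 1, |R| + 2, by positivity, by linarith⟩
  obtain ⟨x, hx₀, hx⟩ := exists_isIntegralCurve_of_hasCompactSupport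
    (G := fun y => χ y • F y) (χ.contDiff.smul hF) χ.hasCompactSupport.smul_right t₀ ξ
  have hsolves : ∀ (s : Set ℝ), (∀ t ∈ s, ‖x t - ξ‖ ≤ |R| + 1) →
      IsIntegralCurveOn x (fun _ => F) s := fun s hs t ht => by
    have hderiv := (hx t).hasDerivWithinAt (s := s)
    simp only [χ.one_of_mem_closedBall (mem_closedBall_iff_norm.2 (hs t ht)), one_smul] at hderiv
    exact hderiv
  have hcont : Continuous fun t => ‖x t - ξ‖ :=
    (continuous_iff_continuousAt.2 fun t => (hx t).continuousAt).sub continuous_const |>.norm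
  refine ⟨x, hx₀, hsolves _ fun T hT => ?_⟩
  by_contra! hexit
  have hstart : ‖x t₀ - ξ‖ < |R| + 1 := by
    rw [hx₀, sub_self, norm_zero]
    positivity
  obtain ⟨τ, hτ, hge, hle⟩ := exists_first_time_ge hcont hT hstart hexit.le
  linarith [hbound τ x hτ.1 hx₀ (hsolves _ hle), le_abs_self R]

end GlobalExistence

section ForwardSolutions

variable {n : ℕ} {F : Vec n → Vec n} {X : Set (Vec n)} {p : Vec n}

namespace IsForwardSolution

variable {t₀ : ℝ} {ξ : Vec n} {x : ℝ → Vec n}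

theorem isIntegralCurveOn_Icc {J : Set ℝ} (hx : IsForwardSolution F t₀ ξ J x) {t : ℝ}
    (ht : t ∈ J) : IsIntegralCurveOn x (fun _ => F) (Icc t₀ t) :=
  hx.solves.mono (hx.ordConnected.out hx.isLeast.1 ht)

theorem of_isIntegralCurveOn_Icc {T : ℝ} (hT : t₀ ≤ T) (hx₀ : x t₀ = ξ)
    (hx : IsIntegralCurveOn x (fun _ => F) (Icc t₀ T)) : IsForwardSolution F t₀ ξ (Icc t₀ T) x :=
  ⟨ordConnected_Icc, isLeast_Icc hT, hx₀, hx⟩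

end IsForwardSolution

theorem UniformExpConverges.mono {S S' : Set (Vec n)} (h : UniformExpConverges F S p)
    (hS : S' ⊆ S) : UniformExpConverges F S' p := by
  obtain ⟨hcomplete, c, hc, r, hr, hdecay⟩ := h
  exact ⟨fun t₀ ξ hξ => hcomplete t₀ ξ (hS hξ), c, hc, r, hr,
    fun t₀ ξ hξ => hdecay t₀ ξ (hS hξ)⟩

theorem forwardComplete_of_bounded (hF : ContDiff ℝ 1 F)
    (hbound : ∀ t₀, ∀ ξ ∈ X, ∃ R, ∀ (T : ℝ) (x : ℝ → Vec n), t₀ ≤ T →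
      IsForwardSolution F t₀ ξ (Icc t₀ T) x → ‖x T - ξ‖ ≤ R) : ForwardComplete F X := by
  intro t₀ ξ hξ
  obtain ⟨R, hR⟩ := hbound t₀ ξ hξ
  obtain ⟨x, hx₀, hx⟩ := exists_isIntegralCurveOn_Ici_of_bounded hF fun T x hT hx₀ hx =>
    hR T x hT (.of_isIntegralCurveOn_Icc hT hx₀ hx)
  exact ⟨x, ordConnected_Ici, isLeast_Ici, hx₀, hx⟩

theorem ForwardInvariant.forwardComplete_of_isBounded (hinv : ForwardInvariant F X)
    (hF : ContDiff ℝ 1 F) (hX : Bornology.IsBounded X) : ForwardComplete F X :=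
  forwardComplete_of_bounded hF fun t₀ ξ hξ => ⟨diam X, fun T x hT hx => by
    rw [← dist_eq_norm]
    exact dist_le_diam_of_mem hX (hinv t₀ ξ hξ _ x hx T (right_mem_Icc.2 hT)) hξ⟩

end ForwardSolutions

section Lyapunov

variable {n : ℕ} {F : Vec n → Vec n} {X : Set (Vec n)} {p : Vec n}
  {b : Vec n →L[ℝ] Vec n →L[ℝ] ℝ} {m M κ : ℝ}

theorem IsLyapunovForm.uniformExpConverges (hb : IsLyapunovForm b m M) (hκ : 0 < κ)
    (hinv : ForwardInvariant F X) (hcomplete : ForwardComplete F X)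
    (hdecay : ∀ x ∈ X, b (x - p) (F x) ≤ -κ * b (x - p) (x - p)) :
    UniformExpConverges F X p := by
  refine ⟨hcomplete, √(M / m), hb.norm_equivalence_pos, κ, hκ, fun t₀ ξ hξ J x hx t ht => ?_⟩
  have hxt := hx.isIntegralCurveOn_Icc ht
  rw [← hx.initial]
  exact hb.norm_le_exp_mul_of_hasDerivWithinAt (fun s hs => (hxt s hs).sub_const p)
    (fun s hs => hdecay _ (hinv t₀ ξ hξ J x hx s (hx.ordConnected.out hx.isLeast.1 ht hs)))
    (right_mem_Icc.2 (hx.isLeast.2 ht))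

/-- The sublevel set of the quadratic Lyapunov function `x ↦ b (x - p) (x - p)`, an ellipsoid
centred at `p`. -/
def ellipsoid (b : Vec n →L[ℝ] Vec n →L[ℝ] ℝ) (p : Vec n) (ρ : ℝ) : Set (Vec n) :=
  {x | b (x - p) (x - p) ≤ ρ}

namespace IsLyapunovForm

theorem ellipsoid_subset_closedBall (hb : IsLyapunovForm b m M) {r : ℝ} (hr : 0 ≤ r) :
    ellipsoid b p (m * r ^ 2) ⊆ closedBall p r := fun x hx => by
  have hsq := le_of_mul_le_mul_left ((hb.lower_le (x - p)).trans hx) hb.lower_pos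
  exact mem_closedBall_iff_norm.2 ((pow_le_pow_iff_left₀ (norm_nonneg _) hr two_ne_zero).1 hsq)

theorem ball_subset_ellipsoid (hb : IsLyapunovForm b m M) (r : ℝ) :
    ball p (√(m / M) * r) ⊆ ellipsoid b p (m * r ^ 2) := fun x hx => by
  have hM := hb.upper_pos
  calc b (x - p) (x - p) ≤ M * ‖x - p‖ ^ 2 := hb.le_upper _
    _ ≤ M * (√(m / M) * r) ^ 2 := by
      gcongr
      exact (mem_ball_iff_norm.1 hx).le
    _ = m * r ^ 2 := by
      rw [mul_pow, Real.sq_sqrt (div_pos hb.lower_pos hM).le]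
      field_simp

theorem forwardInvariant_ellipsoid (hb : IsLyapunovForm b m M) {ρ : ℝ}
    (hinward : ∀ x, b (x - p) (x - p) = ρ → b (x - p) (F x) < 0) :
    ForwardInvariant F (ellipsoid b p ρ) := by
  intro t₀ ξ hξ J x hx t ht
  have hderiv : ∀ s ∈ Icc t₀ t, HasDerivWithinAt (fun s => b (x s - p) (x s - p))
      (2 * b (x s - p) (F (x s))) (Icc t₀ t) s := fun s hs =>
    hb.hasDerivWithinAt ((hx.isIntegralCurveOn_Icc ht s hs).sub_const p)
  exact image_le_of_deriv_right_lt_deriv_boundary (B := fun _ => ρ) (B' := fun _ => 0)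
    (fun s hs => (hderiv s hs).continuousWithinAt)
    (fun s hs => (hderiv s ⟨hs.1, hs.2.le⟩).mono_of_mem_nhdsWithin (Icc_mem_nhdsGE_of_mem hs))
    (hx.initial ▸ hξ) (fun s => hasDerivAt_const s ρ)
    (fun s _ hs => mul_neg_of_pos_of_neg two_pos (hinward _ hs))
    (right_mem_Icc.2 (hx.isLeast.2 ht))

theorem uniformExpStable (hb : IsLyapunovForm b m M) (hκ : 0 < κ) (hF : ContDiff ℝ 1 F)
    (hdecay : ∀ᶠ x in 𝓝 p, b (x - p) (F x) ≤ -κ * b (x - p) (x - p)) :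
    UniformExpStable F p := by
  obtain ⟨r, hr, hball⟩ := nhds_basis_closedBall.eventually_iff.1 hdecay
  have hm := hb.lower_pos
  have hsub := hb.ellipsoid_subset_closedBall (p := p) hr.le
  have hdecay' : ∀ x ∈ ellipsoid b p (m * r ^ 2),
      b (x - p) (F x) ≤ -κ * b (x - p) (x - p) := fun x hx => hball (hsub hx)
  have hinv : ForwardInvariant F (ellipsoid b p (m * r ^ 2)) :=
    hb.forwardInvariant_ellipsoid fun x hx => by
      refine (hdecay' x hx.le).trans_lt ?_
      rw [hx, neg_mul, neg_lt_zero]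
      positivity
  refine ⟨√(m / M) * r, mul_pos (Real.sqrt_pos.2 (div_pos hm hb.upper_pos)) hr, ?_⟩
  exact (hb.uniformExpConverges hκ hinv
    (hinv.forwardComplete_of_isBounded hF (isBounded_closedBall.subset hsub)) hdecay').mono
    (hb.ball_subset_ellipsoid r)

end IsLyapunovForm

end Lyapunov

section ContractingDynamics

variable {n : ℕ} {F : Vec n → Vec n} {X : Set (Vec n)} {b : Vec n →L[ℝ] Vec n →L[ℝ] ℝ}
  {m M κ : ℝ}

namespace IsInfinitesimallyContractingOn

theorem forwardComplete (h : IsInfinitesimallyContractingOn b κ F X) (hb : IsLyapunovForm b m M)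
    (hκ : 0 < κ) (hF : ContDiff ℝ 1 F) (hinv : ForwardInvariant F X) : ForwardComplete F X :=
  forwardComplete_of_bounded hF fun t₀ ξ hξ => ⟨√(M / m) / κ * ‖F ξ‖, fun T x hT hx => by
    rw [← hx.initial]
    exact h.norm_sub_le hb hκ (hF.differentiable one_ne_zero) hT hx.solves
      (hinv t₀ ξ hξ _ x hx)⟩

theorem exists_equilibrium (h : IsInfinitesimallyContractingOn b κ F X)
    (hb : IsLyapunovForm b m M) (hκ : 0 < κ) (hF : ContDiff ℝ 1 F) (hne : X.Nonempty)
    (hcl : IsClosed X) (hinv : ForwardInvariant F X) : ∃ p ∈ X, F p = 0 := by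
  obtain ⟨ξ, hξ⟩ := hne
  obtain ⟨x, hx⟩ := h.forwardComplete hb hκ hF hinv 0 ξ hξ
  have hdiff := hF.differentiable one_ne_zero
  have hxX : ∀ t, 0 ≤ t → x t ∈ X := fun t ht => hinv 0 ξ hξ _ x hx t ht
  have hspeed : Tendsto (fun k : ℕ => F (x k)) atTop (𝓝 0) := by
    have hexp : Tendsto (fun k : ℕ => Real.exp (-κ * (k - 0))) atTop (𝓝 0) := by
      refine Real.tendsto_exp_atBot.comp ?_
      simpa using tendsto_natCast_atTop_atTop.const_mul_atTop hκ
    refine squeeze_zero_norm (fun k => h.norm_field_le hb hdiff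
      (hx.isIntegralCurveOn_Icc (mem_Ici.2 k.cast_nonneg)) (fun t ht => hxX t ht.1)
      (right_mem_Icc.2 k.cast_nonneg)) ?_
    simpa using (hexp.const_mul √(M / m)).mul_const ‖F (x 0)‖
  have hcauchy : CauchySeq fun k : ℕ => x k := by
    refine cauchySeq_of_le_tendsto_0' (fun k : ℕ => √(M / m) / κ * ‖F (x k)‖)
      (fun k l hkl => ?_) (by simpa using hspeed.norm.const_mul (√(M / m) / κ))
    rw [dist_comm, dist_eq_norm]
    exact h.norm_sub_le hb hκ hdiff (by gcongr)
      (hx.solves.mono fun t ht => k.cast_nonneg.trans ht.1)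
      fun t ht => hxX t (k.cast_nonneg.trans ht.1)
  obtain ⟨p, hp⟩ := cauchySeq_tendsto_of_complete hcauchy
  exact ⟨p, hcl.mem_of_tendsto hp (.of_forall fun k => hxX k k.cast_nonneg),
    tendsto_nhds_unique ((hF.continuous.tendsto p).comp hp) hspeed⟩

theorem exists_unique_stable_equilibrium (h : IsInfinitesimallyContractingOn b κ F X)
    (hb : IsLyapunovForm b m M) (hκ : 0 < κ) (hF : ContDiff ℝ 1 F) (hne : X.Nonempty)
    (hconv : Convex ℝ X) (hcl : IsClosed X) (hinv : ForwardInvariant F X) :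
    ∃ p ∈ X, F p = 0 ∧ (∀ y ∈ X, F y = 0 → y = p) ∧
      UniformExpStable F p ∧ UniformExpConverges F X p := by
  have hdiff := hF.differentiable one_ne_zero
  obtain ⟨p, hpX, hp⟩ := h.exists_equilibrium hb hκ hF hne hcl hinv
  have hdecay : ∀ x ∈ X, b (x - p) (F x) ≤ -κ * b (x - p) (x - p) := fun x hx => by
    simpa only [hp, sub_zero] using h.apply_sub_le hdiff hconv hx hpX
  refine ⟨p, hpX, hp, fun y hy hFy => ?_, ?_, ?_⟩
  · have hle := hdecay y hy
    rw [hFy, map_zero] at hle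
    exact sub_eq_zero.1 (hb.eq_zero_of_nonpos (by nlinarith))
  · exact hb.uniformExpStable (half_pos hκ) hF
      (hb.eventually_apply_le_of_hasFDerivAt (hdiff p).hasFDerivAt hp (h p hpX) (half_lt_self hκ))
  · exact hb.uniformExpConverges hκ hinv (h.forwardComplete hb hκ hF hinv) hdecay

end IsInfinitesimallyContractingOn

end ContractingDynamics

section MatrixForm

variable {k : ℕ} {S : Matrix (Fin k) (Fin k) ℝ}

/-- The bilinear form `(v, w) ↦ vᵀ Sᵀ w` on `ℝᵏ`; for symmetric `S` it is the polarisation of the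
quadratic form `v ↦ vᵀ S v`. -/
noncomputable def matrixForm (S : Matrix (Fin k) (Fin k) ℝ) : Vec k →L[ℝ] Vec k →L[ℝ] ℝ :=
  (innerSL ℝ).comp (toEuclideanCLM (𝕜 := ℝ) S)

theorem matrixForm_apply (S : Matrix (Fin k) (Fin k) ℝ) (v w : Vec k) :
    matrixForm S v w = (S *ᵥ v.ofLp) ⬝ᵥ w.ofLp := by
  rw [dotProduct_comm]
  simp [matrixForm, EuclideanSpace.inner_eq_star_dotProduct]

theorem exists_isLyapunovForm_matrixForm (hS : S.PosDef) :
    ∃ m M, IsLyapunovForm (matrixForm S) m M := by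
  refine exists_isLyapunovForm (fun v w => ?_) fun v hv => ?_
  · have hT : Sᵀ = S := by simpa using hS.isHermitian.eq
    rw [matrixForm_apply, matrixForm_apply, dotProduct_comm, ← dotProduct_transpose_mulVec, hT,
      dotProduct_comm]
  · rw [matrixForm_apply, dotProduct_comm]
    simpa using hS.dotProduct_mulVec_pos (x := v.ofLp) (by simpa using hv)

theorem matrixForm_inv_self_le {M : ℝ} (hS : IsUnit S.det)
    (hM : ∀ v, matrixForm S v v ≤ M * ‖v‖ ^ 2) (v : Vec k) :
    matrixForm S⁻¹ v v ≤ M * ((S⁻¹ *ᵥ v.ofLp) ⬝ᵥ (S⁻¹ *ᵥ v.ofLp)) := by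
  have hle := hM (WithLp.toLp 2 (S⁻¹ *ᵥ v.ofLp))
  rw [matrixForm_apply, mulVec_mulVec, mul_nonsing_inv _ hS, one_mulVec, dotProduct_comm,
    EuclideanSpace.real_norm_sq_eq] at hle
  simpa only [matrixForm_apply, dotProduct, sq] using hle

end MatrixForm

section ClosedLoop

variable {n m q τ T : ℕ} {Q : Vec n → Vec q} {A : Matrix (Fin n) (Fin n ⊕ Fin q) ℝ}
  {B : Matrix (Fin n) (Fin m) ℝ} {K : Matrix (Fin m) (Fin n ⊕ Fin q) ℝ}

theorem ofLp_fderiv_eq_jacobian_mulVec (Q : Vec n → Vec q) (x v : Vec n) :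
    (fderiv ℝ Q x v).ofLp = jacobian Q x *ᵥ v.ofLp := by
  ext i
  have hv : v = ∑ j, v j • EuclideanSpace.single j (1 : ℝ) := by
    simpa using ((EuclideanSpace.basisFun (Fin n) ℝ).sum_repr v).symm
  conv_lhs => rw [hv]
  simp [map_sum, jacobian, mulVec, dotProduct, mul_comm]

theorem closedLoop_eq_comp (A : Matrix (Fin n) (Fin n ⊕ Fin q) ℝ) (B : Matrix (Fin n) (Fin m) ℝ)
    (K : Matrix (Fin m) (Fin n ⊕ Fin q) ℝ) (Q : Vec n → Vec q) :
    closedLoop A B K Q = (toLpLin 2 2 (A + B * K)).toContinuousLinearMap ∘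
      fun x => WithLp.toLp 2 (dictionary Q x) :=
  rfl

theorem contDiff_closedLoop {r : WithTop ℕ∞} (hQ : ContDiff ℝ r Q) :
    ContDiff ℝ r (closedLoop A B K Q) := by
  rw [closedLoop_eq_comp]
  refine (ContinuousLinearMap.contDiff _).comp (contDiff_euclidean.2 fun i => ?_)
  cases i with
  | inl i => exact (EuclideanSpace.proj (𝕜 := ℝ) i).contDiff
  | inr j => exact (EuclideanSpace.proj (𝕜 := ℝ) j).contDiff.comp hQ

theorem hasFDerivAt_toLp_dictionary {x : Vec n} (hQ : DifferentiableAt ℝ Q x) :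
    HasFDerivAt (fun x => WithLp.toLp 2 (dictionary Q x))
      (toLpLin 2 2 (fromRows 1 (jacobian Q x))).toContinuousLinearMap x := by
  refine hasFDerivWithinAt_univ.1 (hasFDerivWithinAt_euclidean.2 fun i => ?_)
  rw [hasFDerivWithinAt_univ]
  cases i with
  | inl i =>
    refine (EuclideanSpace.proj (𝕜 := ℝ) i).hasFDerivAt.congr_fderiv ?_
    ext v
    simp [fromRows_mulVec]
  | inr j =>
    refine ((EuclideanSpace.proj (𝕜 := ℝ) j).hasFDerivAt.comp x hQ.hasFDerivAt).congr_fderiv ?_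
    ext v
    simp [fromRows_mulVec, ← ofLp_fderiv_eq_jacobian_mulVec]

theorem fderiv_closedLoop_apply {x : Vec n} (hQ : DifferentiableAt ℝ Q x) (v : Vec n) :
    fderiv ℝ (closedLoop A B K Q) x v =
      WithLp.toLp 2 ((A + B * K) *ᵥ Sum.elim v.ofLp (jacobian Q x *ᵥ v.ofLp)) := by
  rw [closedLoop_eq_comp,
    ((ContinuousLinearMap.hasFDerivAt _).comp x (hasFDerivAt_toLp_dictionary hQ)).fderiv]
  simp [toLpLin_apply, fromRows_mulVec, add_mulVec]

theorem sampleMatrix_eq {f : Vec n → Vec n}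
    (hf : ∀ x, f x = WithLp.toLp 2 (A *ᵥ dictionary Q x))
    {xs : Fin T → Vec n} {us : Fin T → Vec m} {dxs : Fin T → Vec n}
    (hdata : ∀ i, dxs i = f (xs i) + WithLp.toLp 2 (B *ᵥ (us i).ofLp)) :
    sampleMatrix dxs = A * dictionaryMatrix Q xs + B * sampleMatrix us := by
  ext i t
  simp [sampleMatrix, hdata, hf, dictionaryMatrix, mul_apply, mulVec, dotProduct]

theorem dotProduct_lmiMatrix_mulVec (X₁ : Matrix (Fin n) (Fin T) ℝ)
    (RQ : Matrix (Fin n) (Fin τ) ℝ) (P : Matrix (Fin n) (Fin n) ℝ)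
    (Y₁ : Matrix (Fin T) (Fin n) ℝ) (G₂ : Matrix (Fin T) (Fin q) ℝ) (α : ℝ) (u : Fin n → ℝ)
    (v : Fin q → ℝ) (w : Fin τ → ℝ) :
    Sum.elim (Sum.elim u v) w ⬝ᵥ (lmiMatrix X₁ RQ P Y₁ G₂ α *ᵥ Sum.elim (Sum.elim u v) w) =
      2 * (u ⬝ᵥ ((X₁ * Y₁) *ᵥ u)) + α * (u ⬝ᵥ u) + 2 * (u ⬝ᵥ ((X₁ * G₂) *ᵥ v)) - v ⬝ᵥ v
        + 2 * (w ⬝ᵥ ((RQᵀ * P) *ᵥ u)) - w ⬝ᵥ w := by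
  simp only [lmiMatrix, ← transpose_mul, transpose_transpose, fromBlocks_mulVec,
    Sum.elim_comp_inl, Sum.elim_comp_inr, fromRows_mulVec, fromCols_mulVec_sumElim,
    sumElim_dotProduct_sumElim, zero_mulVec, add_zero, neg_mulVec, one_mulVec, ← Sum.elim_add_add,
    dotProduct_add, dotProduct_neg, add_mulVec, smul_mulVec, dotProduct_smul, smul_eq_mul,
    dotProduct_transpose_mulVec]
  ring

namespace SDPFeasible

variable {X₁ : Matrix (Fin n) (Fin T) ℝ} {Z₀ : Matrix (Fin n ⊕ Fin q) (Fin T) ℝ}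
  {RQ : Matrix (Fin n) (Fin τ) ℝ} {P : Matrix (Fin n) (Fin n) ℝ} {Y₁ : Matrix (Fin T) (Fin n) ℝ}
  {G₂ : Matrix (Fin T) (Fin q) ℝ} {α : ℝ}

theorem isUnit_det (h : SDPFeasible X₁ Z₀ RQ P Y₁ G₂ α) : IsUnit P.det :=
  h.posDef.det_pos.ne'.isUnit

theorem add_mul_gain_eq (h : SDPFeasible X₁ Z₀ RQ P Y₁ G₂ α) {U₀ : Matrix (Fin m) (Fin T) ℝ}
    (hX₁ : X₁ = A * Z₀ + B * U₀) :
    A + B * gain U₀ P Y₁ G₂ = fromCols (X₁ * Y₁ * P⁻¹) (X₁ * G₂) := by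
  have hright_inverse : Z₀ * fromCols (Y₁ * P⁻¹) G₂ = 1 := by
    rw [mul_fromCols, ← Matrix.mul_assoc, h.consistency_left, h.consistency_right, fromRows_mul,
      Matrix.zero_mul, mul_nonsing_inv _ h.isUnit_det, fromCols_fromRows_eq_fromBlocks,
      fromBlocks_one]
  rw [Matrix.mul_assoc X₁, ← mul_fromCols, hX₁, Matrix.add_mul, Matrix.mul_assoc, hright_inverse,
    Matrix.mul_one, gain, Matrix.mul_assoc]

theorem dotProduct_mulVec_le (h : SDPFeasible X₁ Z₀ RQ P Y₁ G₂ α) {D : Matrix (Fin q) (Fin n) ℝ}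
    (hD : (RQ * RQᵀ - Dᵀ * D).PosSemidef) (v : Fin n → ℝ) :
    2 * ((P⁻¹ *ᵥ v) ⬝ᵥ ((X₁ * Y₁ * P⁻¹ + X₁ * G₂ * D) *ᵥ v)) ≤
      -α * ((P⁻¹ *ᵥ v) ⬝ᵥ (P⁻¹ *ᵥ v)) := by
  have hlmi := h.lmi.dotProduct_mulVec_nonneg
    (Sum.elim (Sum.elim (P⁻¹ *ᵥ v) (D *ᵥ v)) (RQᵀ *ᵥ v))
  have hjacobian : (D *ᵥ v) ⬝ᵥ (D *ᵥ v) ≤ (RQᵀ *ᵥ v) ⬝ᵥ (RQᵀ *ᵥ v) := by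
    have hnonneg := hD.dotProduct_mulVec_nonneg v
    rw [star_trivial, sub_mulVec, dotProduct_sub, ← mulVec_mulVec, ← mulVec_mulVec,
      dotProduct_transpose_mulVec, dotProduct_mulVec v RQ, ← mulVec_transpose] at hnonneg
    linarith
  rw [star_trivial, neg_mulVec, dotProduct_neg, dotProduct_lmiMatrix_mulVec] at hlmi
  simp only [← mulVec_mulVec, mulVec_mulVec _ P P⁻¹, mul_nonsing_inv _ h.isUnit_det, one_mulVec]
    at hlmi
  simp only [add_mulVec, ← mulVec_mulVec, dotProduct_add]
  linarith

theorem exists_isInfinitesimallyContractingOn (h : SDPFeasible X₁ Z₀ RQ P Y₁ G₂ α)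
    (hQ : Differentiable ℝ Q) {X : Set (Vec n)} (hRQ : JacobianBound Q RQ X)
    (hK : A + B * K = fromCols (X₁ * Y₁ * P⁻¹) (X₁ * G₂)) :
    ∃ κ > 0, IsInfinitesimallyContractingOn (matrixForm P⁻¹) κ (closedLoop A B K Q) X := by
  obtain ⟨m, M, hP⟩ := exists_isLyapunovForm_matrixForm h.posDef
  have hM := hP.upper_pos
  have hα := h.alpha_pos
  refine ⟨α / (2 * M), by positivity, fun x hx v => ?_⟩
  have hinv := matrixForm_inv_self_le h.isUnit_det hP.le_upper v
  have hdecay := h.dotProduct_mulVec_le (hRQ x hx) v.ofLp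
  calc matrixForm P⁻¹ v (fderiv ℝ (closedLoop A B K Q) x v)
      = (P⁻¹ *ᵥ v.ofLp) ⬝ᵥ ((X₁ * Y₁ * P⁻¹ + X₁ * G₂ * jacobian Q x) *ᵥ v.ofLp) := by
        rw [fderiv_closedLoop_apply (hQ x), matrixForm_apply, hK, fromCols_mulVec_sumElim,
          add_mulVec, mulVec_mulVec]
    _ ≤ -(α / 2) * ((P⁻¹ *ᵥ v.ofLp) ⬝ᵥ (P⁻¹ *ᵥ v.ofLp)) := by linarith
    _ ≤ -(α / (2 * M)) * matrixForm P⁻¹ v v := by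
        have := mul_le_mul_of_nonneg_left hinv (by positivity : 0 ≤ α / (2 * M))
        field_simp at this ⊢
        linarith

end SDPFeasible

end ClosedLoop

theorem corollary2_general {n m q τ T : ℕ} (f : Vec n → Vec n) (Q : Vec n → Vec q)
    (hQ : ContDiff ℝ 1 Q) (A : Matrix (Fin n) (Fin n ⊕ Fin q) ℝ) (B : Matrix (Fin n) (Fin m) ℝ)
    (hf : ∀ x, f x = WithLp.toLp 2 (A *ᵥ dictionary Q x))
    (xs : Fin T → Vec n) (us : Fin T → Vec m) (dxs : Fin T → Vec n)
    (hdata : ∀ i, dxs i = f (xs i) + WithLp.toLp 2 (B *ᵥ (us i).ofLp))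
    (RQ : Matrix (Fin n) (Fin τ) ℝ) (X : Set (Vec n)) (hRQ : JacobianBound Q RQ X)
    (P : Matrix (Fin n) (Fin n) ℝ) (Y₁ : Matrix (Fin T) (Fin n) ℝ)
    (G₂ : Matrix (Fin T) (Fin q) ℝ) (α : ℝ)
    (hSDP : SDPFeasible (sampleMatrix dxs) (dictionaryMatrix Q xs) RQ P Y₁ G₂ α)
    (K : Matrix (Fin m) (Fin n ⊕ Fin q) ℝ) (hK : K = gain (sampleMatrix us) P Y₁ G₂)
    (F : Vec n → Vec n) (hF : F = closedLoop A B K Q)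
    (hne : X.Nonempty) (hconv : Convex ℝ X) (hcl : IsClosed X) (hinv : ForwardInvariant F X) :
    ∃ p ∈ X, F p = 0 ∧ (∀ y ∈ X, F y = 0 → y = p) ∧
      UniformExpStable F p ∧ UniformExpConverges F X p := by
  subst hF hK
  obtain ⟨κ, hκ, hcontracting⟩ := hSDP.exists_isInfinitesimallyContractingOn
    (hQ.differentiable one_ne_zero) hRQ (hSDP.add_mul_gain_eq (sampleMatrix_eq hf hdata))
  obtain ⟨_, _, hlyapunov⟩ := exists_isLyapunovForm_matrixForm hSDP.posDef.inv
  exact hcontracting.exists_unique_stable_equilibrium hlyapunov hκ (contDiff_closedLoop hQ)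
    hne hconv hcl hinv

theorem corollary2 {n m q τ T : ℕ}
    -- the plant, with its dictionary representation
    (f : Vec n → Vec n) (Q : Vec n → Vec q) (hQ : ContDiff ℝ 1 Q)
    (A : Matrix (Fin n) (Fin n ⊕ Fin q) ℝ) (B : Matrix (Fin n) (Fin m) ℝ)
    (hf : ∀ x, f x = WithLp.toLp 2 (A *ᵥ dictionary Q x))
    -- the dataset
    (xs : Fin T → Vec n) (us : Fin T → Vec m) (dxs : Fin T → Vec n)
    (hdata : ∀ i, dxs i = f (xs i) + WithLp.toLp 2 (B *ᵥ (us i).ofLp))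
    -- the bound on the Jacobian of the nonlinearities on the set `X`
    (RQ : Matrix (Fin n) (Fin τ) ℝ) (X : Set (Vec n)) (hRQ : JacobianBound Q RQ X)
    -- a feasible point of the semidefinite program
    (P : Matrix (Fin n) (Fin n) ℝ) (Y₁ : Matrix (Fin T) (Fin n) ℝ)
    (G₂ : Matrix (Fin T) (Fin q) ℝ) (α : ℝ)
    (hSDP : SDPFeasible (sampleMatrix dxs) (dictionaryMatrix Q xs) RQ P Y₁ G₂ α)
    -- the closed loop
    (K : Matrix (Fin m) (Fin n ⊕ Fin q) ℝ) (hK : K = gain (sampleMatrix us) P Y₁ G₂)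
    (F : Vec n → Vec n) (hF : F = closedLoop A B K Q)
    (hX : (X.Nonempty ∧ Convex ℝ X ∧ IsClosed X ∧ ForwardInvariant F X ∧ ForwardComplete F X) ∨
      X = Set.univ) :
    ∃ p ∈ X, F p = 0 ∧ (∀ y ∈ X, F y = 0 → y = p) ∧
      UniformExpStable F p ∧ UniformExpConverges F X p := by
  rcases hX with ⟨hne, hconv, hcl, hinv, -⟩ | rfl
  · exact corollary2_general f Q hQ A B hf xs us dxs hdata RQ X hRQ P Y₁ G₂ α hSDP K hK F hF
      hne hconv hcl hinv
  · exact corollary2_general f Q hQ A B hf xs us dxs hdata RQ univ hRQ P Y₁ G₂ α hSDP K hK F hF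
      univ_nonempty convex_univ isClosed_univ fun _ _ _ _ _ _ _ _ => mem_univ _
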